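/- Let $\mathbb G$ be a Carnot group, identified with $\mathbb R^n$ by exponential coordinates of the first kind adapted to the stratification of its Lie algebra, with the left-invariant Riemannian metric for which the left-invariant frame $X_1,\dots,X_n$ (with $X_i(0)=e_i$) is orthonormal, and with horizontal bundle $H=\mathrm{span}(X_1,\dots,X_h)$. Let $\varrho$ be a homogeneous distance on $\mathbb G$ (a continuous distance, left-invariant and 1-homogeneous under the dilations), with open balls $B_\varrho(x,R)$. For a hypersurface $S\subset\mathbb G$ of class $C^2$ (an embedded codimension-one submanifold, without boundary points) let $\sigma_H$ be its $H$-perimeter measure, $\sigma_H=\big(\sum_{i\le h}\langle X_i,N\rangle^2\big)^{1/2}\mathcal H^{n-1}_{Eu}\llcorner S$ with $N$ a Euclidean unit normal; let $HS=H\cap TS$, and for $\eta\in C^1(S)$ let $\mathrm{grad}_{HS}\,\eta$ be the section of $HS$ representing $d\eta|_{HS}$. Put $S_R=S\cap B_\varrho(x,R)$. For a measurable section $X$ of $HS$ over $S_R$, locally in $L^2(\sigma_H)$, and $f\in L^2_{loc}(S_R,\sigma_H)$, say that $\mathcal D_{HS}X=f$ on $S_R$ in the distributional sense if $\int_{S_R}\langle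 X,\mathrm{grad}_{HS}\,\eta\rangle\,\sigma_H=-\int_{S_R}f\eta\,\sigma_H$ for all $\eta\in C^1_c(S_R)$. Say that $\phi\in L^2_{loc}(S_R,\sigma_H)$ has weak gradient $\mathrm{grad}_{HS}\,\phi\in L^2_{loc}(S_R,HS;\sigma_H)$ if $\int_{S_R}\langle\mathrm{grad}_{HS}\,\phi,X\rangle\,\sigma_H=-\int_{S_R}\phi\,\mathcal D_{HS}X\,\sigma_H$ for every compactly supported $X\in L^2(S_R,HS;\sigma_H)$ whose distributional divergence $\mathcal D_{HS}X$ is in $L^2(S_R,\sigma_H)$. With $\mathcal L_{HS}\phi=\mathcal D_{HS}(\mathrm{grad}_{HS}\,\phi)$, a distributional solution of $-\mathcal L_{HS}\phi=\psi$ on $S_R$ is a function $\phi$ that has a weak gradient and satisfies $$\int_{S_R}\langle\mathrm{grad}_{HS}\,\phi,\mathrm{grad}_{HS}\,\eta\rangle\,\sigma_H=\int_{S_R}\psi\,\eta\,\sigma_H\qquad\text{for all }\eta\in C^1_c(S_R).$$ **Theorem (Caccioppoli-type inequality).** There is a constant $C>0$, depending only on $\mathbb G$ and $\varrho$, such that for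 every hypersurface $S\subset\mathbb G$ of class $C^2$ and every $x\in S$ there is $R_0>0$ with the following property: for all $0<R\le R_0$, all $\psi\in L^2(S_R,\sigma_H)$, every distributional solution $\phi$ of $-\mathcal L_{HS}\phi=\psi$ on $S_R$ and every constant $\phi_0\in\mathbb R$, $$\int_{S_{R/2}}|\mathrm{grad}_{HS}\,\phi|^2\,\sigma_H\le C\left(\frac1{R^2}\int_{S_R}|\phi-\phi_0|^2\,\sigma_H+R^2\int_{S_R}\psi^2\,\sigma_H\right)$$ (the right-hand side may be $+\infty$). -/

import Mathlib

open MeasureTheory Set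
open scoped ENNReal NNReal

/-- A Carnot group of topological dimension `n`, in exponential coordinates of the first kind
adapted to the stratification; its underlying manifold is `ℝⁿ`, and the standard basis is declared
orthonormal at the identity `0`. -/
structure CarnotGroup (n : ℕ) where
  /-- The group law. -/
  mul : EuclideanSpace ℝ (Fin n) → EuclideanSpace ℝ (Fin n) → EuclideanSpace ℝ (Fin n)
  /-- The group law is polynomial. -/
  mul_polynomial : ∃ p : Fin n → MvPolynomial (Fin n ⊕ Fin n) ℝ,
    ∀ x y i, mul x y i = MvPolynomial.eval (Sum.elim (fun j => x j) (fun j => y j)) (p i)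
  mul_assoc : ∀ x y z, mul (mul x y) z = mul x (mul y z)
  /-- The coordinates are exponential: lines through `0` are one-parameter subgroups.
  In particular `0` is the identity and `-x` is the inverse of `x`. -/
  mul_smul_smul : ∀ (x : EuclideanSpace ℝ (Fin n)) (s t : ℝ), mul (s • x) (t • x) = (s + t) • x
  /-- `ord i` is the index of the layer containing the `i`-th basis vector. -/
  ord : Fin n → ℕ
  one_le_ord : ∀ i, 1 ≤ ord i
  /-- The dilations `δ_t x = (t ^ ord i * x i)_i` are automorphisms. -/
  dilation_mul : ∀ (t : ℝ) (x y : EuclideanSpace ℝ (Fin n)), 0 < t →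
    WithLp.toLp 2 (fun i => t ^ ord i * mul x y i) =
      mul (WithLp.toLp 2 (fun i => t ^ ord i * x i)) (WithLp.toLp 2 (fun i => t ^ ord i * y i))
  /-- The Lie algebra is stratified: `[H₁, Hₘ] = Hₘ₊₁` for every `m ≥ 1`, where `Hₘ` is spanned by
  the basis vectors of order `m` and `[u, v]` is the value at `0` of the Lie bracket of the
  left-invariant vector fields `x ↦ d(L_x)₀ u` and `x ↦ d(L_x)₀ v`. -/
  stratified : ∀ m : ℕ, 1 ≤ m →
    Submodule.span ℝ {w : EuclideanSpace ℝ (Fin n) |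
      ∃ u ∈ Submodule.span ℝ {e | ∃ i, ord i = 1 ∧ e = EuclideanSpace.single i (1 : ℝ)},
      ∃ v ∈ Submodule.span ℝ {e | ∃ i, ord i = m ∧ e = EuclideanSpace.single i (1 : ℝ)},
        w = VectorField.lieBracket ℝ (fun x => fderiv ℝ (mul x) 0 u)
          (fun x => fderiv ℝ (mul x) 0 v) 0} =
      Submodule.span ℝ {e | ∃ i, ord i = m + 1 ∧ e = EuclideanSpace.single i (1 : ℝ)}

namespace CarnotGroup

variable {n : ℕ} (𝔾 : CarnotGroup n)

/-- The dilation `δ_t`. -/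
noncomputable def dilation (t : ℝ) (x : EuclideanSpace ℝ (Fin n)) : EuclideanSpace ℝ (Fin n) :=
  WithLp.toLp 2 (fun i => t ^ 𝔾.ord i * x i)

/-- The left-invariant frame `X_i(x) = d(L_x)₀ e_i`, orthonormal for the left-invariant
Riemannian metric. -/
noncomputable def frame (x : EuclideanSpace ℝ (Fin n)) (i : Fin n) : EuclideanSpace ℝ (Fin n) :=
  fderiv ℝ (𝔾.mul x) 0 (EuclideanSpace.single i (1 : ℝ))

/-- A homogeneous distance on a Carnot group. -/
structure HomogeneousDistance where
  dist : EuclideanSpace ℝ (Fin n) → EuclideanSpace ℝ (Fin n) → ℝ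
  nonneg : ∀ x y, 0 ≤ dist x y
  eq_zero_iff : ∀ x y, dist x y = 0 ↔ x = y
  symm : ∀ x y, dist x y = dist y x
  triangle : ∀ x y z, dist x z ≤ dist x y + dist y z
  continuous : Continuous (Function.uncurry dist)
  left_invariant : ∀ x y z, dist (𝔾.mul z x) (𝔾.mul z y) = dist x y
  homogeneous : ∀ (t : ℝ) x y, 0 ≤ t → dist (𝔾.dilation t x) (𝔾.dilation t y) = t * dist x y

/-- The open ball `B_ϱ(x, R)`. -/
def HomogeneousDistance.ball {𝔾 : CarnotGroup n} (ϱ : 𝔾.HomogeneousDistance)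
    (x : EuclideanSpace ℝ (Fin n)) (R : ℝ) : Set (EuclideanSpace ℝ (Fin n)) :=
  {y | ϱ.dist x y < R}

/-- The indices of the horizontal frame `X_1, …, X_h`. -/
abbrev HIdx : Type := {i : Fin n // 𝔾.ord i = 1}

/-- Horizontal vectors at a point, in coordinates with respect to the orthonormal horizontal frame
at that point (so the norm and inner product are those of the sub-Riemannian metric). -/
abbrev HVec : Type := EuclideanSpace ℝ 𝔾.HIdx

/-- The tangent vector `∑ vᵢ Xᵢ(x)` with horizontal coordinates `v`. -/
noncomputable def hLift (x : EuclideanSpace ℝ (Fin n)) : 𝔾.HVec →ₗ[ℝ] EuclideanSpace ℝ (Fin n) where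
  toFun v := ∑ i : 𝔾.HIdx, v i • 𝔾.frame x i
  map_add' u v := by simp [add_smul, Finset.sum_add_distrib]
  map_smul' c v := by simp [mul_smul, Finset.smul_sum]

end CarnotGroup

/-- `S ⊆ ℝⁿ` is an (embedded) hypersurface of class `C²`, without boundary points. -/
def IsC2Hypersurface {n : ℕ} (S : Set (EuclideanSpace ℝ (Fin n))) : Prop :=
  ∀ x ∈ S, ∃ (U : Set (EuclideanSpace ℝ (Fin n))) (f : EuclideanSpace ℝ (Fin n) → ℝ),
    IsOpen U ∧ x ∈ U ∧ ContDiffOn ℝ 2 f U ∧ (∀ y ∈ U, fderiv ℝ f y ≠ 0) ∧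
      S ∩ U = {y ∈ U | f y = 0}

/-- The tangent space `T_y S`. -/
def tangentSpaceAt {n : ℕ} (S : Set (EuclideanSpace ℝ (Fin n))) (y : EuclideanSpace ℝ (Fin n)) :
    Submodule ℝ (EuclideanSpace ℝ (Fin n)) :=
  Submodule.span ℝ (tangentConeAt ℝ S y)

namespace CarnotGroup

variable {n : ℕ} (𝔾 : CarnotGroup n)

/-- The horizontal tangent space `H_y S = H_y ∩ T_y S`, in horizontal coordinates. -/
noncomputable def HS (S : Set (EuclideanSpace ℝ (Fin n))) (y : EuclideanSpace ℝ (Fin n)) :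
    Submodule ℝ 𝔾.HVec :=
  (tangentSpaceAt S y).comap (𝔾.hLift y)

/-- `grad_H η = ∑ᵢ (Xᵢ η) Xᵢ` (sum over horizontal indices), in horizontal coordinates. -/
noncomputable def gradH (η : EuclideanSpace ℝ (Fin n) → ℝ) (y : EuclideanSpace ℝ (Fin n)) :
    𝔾.HVec :=
  WithLp.toLp 2 (fun i : 𝔾.HIdx => fderiv ℝ η y (𝔾.frame y i))

/-- `grad_HS η`, for (the restriction to `S` of) a `C¹` function `η`: the orthogonal projection of
`grad_H η` onto `HS`, i.e. the horizontal tangent vector that represents `dη` on `HS`. -/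
noncomputable def gradHS (S : Set (EuclideanSpace ℝ (Fin n))) (η : EuclideanSpace ℝ (Fin n) → ℝ)
    (y : EuclideanSpace ℝ (Fin n)) : 𝔾.HVec :=
  (𝔾.HS S y).starProjection (𝔾.gradH η y)

/-- `(∑ᵢ ⟨Xᵢ, N⟩²)^{1/2}`, sum over horizontal indices, with `N` a Euclidean unit normal of `S`
at `y`. The Riemannian unit normal is `ν = ∑ⱼ ⟨Xⱼ, N⟩ Xⱼ / (∑ⱼ ⟨Xⱼ, N⟩²)^{1/2}` (sums over all `j`),
and the Riemannian volume form is `dx₁ ∧ ⋯ ∧ dxₙ`, so this is the density `⟨ν_H, N⟩` of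
`ν_H ⌟ dx₁ ∧ ⋯ ∧ dxₙ` with respect to Euclidean surface measure. It vanishes exactly at
characteristic points. -/
noncomputable def hNormalLength (S : Set (EuclideanSpace ℝ (Fin n)))
    (y : EuclideanSpace ℝ (Fin n)) : ℝ :=
  Real.sqrt (∑ i : 𝔾.HIdx, ‖(tangentSpaceAt S y)ᗮ.starProjection (𝔾.frame y i)‖ ^ 2)

/-- The `H`-perimeter measure `σ_H` on the hypersurface `S`. -/
noncomputable def hPerimeter (S : Set (EuclideanSpace ℝ (Fin n))) :
    Measure (EuclideanSpace ℝ (Fin n)) :=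
  ((μHE[n - 1] : Measure (EuclideanSpace ℝ (Fin n))).restrict S).withDensity
    (fun y => ENNReal.ofReal (𝔾.hNormalLength S y))

end CarnotGroup

/-- `C¹` test functions on `S ∩ U` with compact support in `S ∩ U`, represented by a `C¹` extension
to the ambient space. -/
def IsTestFunction {n : ℕ} (S U : Set (EuclideanSpace ℝ (Fin n)))
    (η : EuclideanSpace ℝ (Fin n) → ℝ) : Prop :=
  ContDiff ℝ 1 η ∧ ∃ K, IsCompact K ∧ K ⊆ S ∩ U ∧ ∀ y ∈ S \ K, η y = 0

namespace CarnotGroup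

variable {n : ℕ} (𝔾 : CarnotGroup n)

/-- `f` is square integrable with respect to `σ_H` on compact subsets of `S ∩ U`. -/
def IsL2Loc {F : Type} [NormedAddCommGroup F] (S U : Set (EuclideanSpace ℝ (Fin n)))
    (f : EuclideanSpace ℝ (Fin n) → F) : Prop :=
  ∀ K, IsCompact K → K ⊆ S ∩ U → MemLp f 2 ((𝔾.hPerimeter S).restrict K)

/-- `X` is a.e. on `S ∩ U` tangent to `HS`. -/
def IsHSField (S U : Set (EuclideanSpace ℝ (Fin n)))
    (X : EuclideanSpace ℝ (Fin n) → 𝔾.HVec) : Prop :=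
  ∀ᵐ y ∂((𝔾.hPerimeter S).restrict U), X y ∈ 𝔾.HS S y

/-- `𝓓_HS X = f` on `S ∩ U` in the sense of distributions, `𝓓_HS` being minus the formal adjoint
of `grad_HS` in `L²(σ_H)`. (For `C¹` fields, the horizontal divergence formula identifies it with
`div_HS X + ⟨C_H ν_H, X⟩` at noncharacteristic points.) -/
def IsDistribDHS (S U : Set (EuclideanSpace ℝ (Fin n)))
    (X : EuclideanSpace ℝ (Fin n) → 𝔾.HVec) (f : EuclideanSpace ℝ (Fin n) → ℝ) : Prop :=
  ∀ η, IsTestFunction S U η →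
    ∫ y in U, inner ℝ (X y) (𝔾.gradHS S η y) ∂(𝔾.hPerimeter S) =
      -∫ y in U, f y * η y ∂(𝔾.hPerimeter S)

/-- `φ` belongs to the local Sobolev space `W^{1,2}_{HS,loc}(S ∩ U)` and `G` is its weak gradient
`grad_HS φ`: integration by parts holds against every compactly supported `L²` field tangent to `HS`
whose distributional divergence `𝓓_HS X` is in `L²`. -/
structure IsWeakGradHS (S U : Set (EuclideanSpace ℝ (Fin n)))
    (φ : EuclideanSpace ℝ (Fin n) → ℝ) (G : EuclideanSpace ℝ (Fin n) → 𝔾.HVec) : Prop where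
  l2Loc : 𝔾.IsL2Loc S U φ
  l2Loc_grad : 𝔾.IsL2Loc S U G
  tangent : 𝔾.IsHSField S U G
  integral_eq : ∀ (X : EuclideanSpace ℝ (Fin n) → 𝔾.HVec) (f : EuclideanSpace ℝ (Fin n) → ℝ)
    (K : Set (EuclideanSpace ℝ (Fin n))), IsCompact K → K ⊆ S ∩ U →
    (∀ y ∈ S \ K, X y = 0 ∧ f y = 0) →
    MemLp X 2 ((𝔾.hPerimeter S).restrict U) → MemLp f 2 ((𝔾.hPerimeter S).restrict U) →
    𝔾.IsHSField S U X → 𝔾.IsDistribDHS S U X f →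
    ∫ y in U, inner ℝ (G y) (X y) ∂(𝔾.hPerimeter S) = -∫ y in U, φ y * f y ∂(𝔾.hPerimeter S)

/-- `φ`, with weak gradient `G = grad_HS φ`, solves `-𝓛_HS φ = ψ` on `S ∩ U` in the sense of
distributions, where `𝓛_HS φ = 𝓓_HS (grad_HS φ)`; that is,
`∫ ⟨grad_HS φ, grad_HS η⟩ σ_H = ∫ ψ η σ_H` for all test functions `η`. -/
def IsDistribSolution (S U : Set (EuclideanSpace ℝ (Fin n)))
    (φ : EuclideanSpace ℝ (Fin n) → ℝ) (G : EuclideanSpace ℝ (Fin n) → 𝔾.HVec)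
    (ψ : EuclideanSpace ℝ (Fin n) → ℝ) : Prop :=
  𝔾.IsWeakGradHS S U φ G ∧ 𝔾.IsDistribDHS S U G (fun y => -ψ y)

end CarnotGroup

/-!
The classical argument tests the equation with `ζ² (φ - φ₀)`, where `ζ` is a cutoff function equal
to one on `B(x, R/2)`, with compact support on `S ∩ B(x, R)` and `|grad_H ζ| ≤ M / R`. As the weak
gradient `G` of `φ` is defined by duality, that function is not an admissible test function, and
the roles are exchanged: the field `X = ζ² G` is used as a test field for `φ`. By the product rule
on test functions its distributional divergence is `f = 2 ζ ⟨G, grad ζ⟩ - ζ² ψ`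
(`CarnotGroup.isDistribDHS_sq_smul`), which has mean zero, as one sees by testing the equation
with `ζ²`. Hence `∫ ζ² |G|² = -∫ (φ - φ₀) f`, and Young's inequality absorbs the gradient term
(`CarnotGroup.lintegral_cutoff_smul_grad_le`).

The cutoff functions are left translates and dilates of a single bump function, and the horizontal
frame is left-invariant and homogeneous of degree one, so `M` depends only on the group and the
distance (`CarnotGroup.HomogeneousDistance.exists_cutoff`).

The radius `R₀` is such that closed homogeneous balls of radius at most `R₀` meet `S` in a compact
set of finite `H`-perimeter. Finiteness makes `L²` fields integrable against test functions. It
follows from `exists_isOpen_hausdorffMeasure_lt_top`: near `x`, the orthogonal projection to `T_x S`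
is antilipschitz on `S`.
-/

open Filter Topology

/-! ### Group law, dilations and horizontal gradient -/

namespace CarnotGroup

variable {n : ℕ} (𝔾 : CarnotGroup n)

theorem mul_zero (x : EuclideanSpace ℝ (Fin n)) : 𝔾.mul x 0 = x := by
  simpa using 𝔾.mul_smul_smul x 1 0

theorem neg_mul_self (x : EuclideanSpace ℝ (Fin n)) : 𝔾.mul (-x) x = 0 := by
  simpa using 𝔾.mul_smul_smul x (-1) 1

theorem mul_neg_self (x : EuclideanSpace ℝ (Fin n)) : 𝔾.mul x (-x) = 0 := by
  simpa using 𝔾.mul_smul_smul x 1 (-1)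

theorem zero_mul (x : EuclideanSpace ℝ (Fin n)) : 𝔾.mul 0 x = x := by
  simpa using 𝔾.mul_smul_smul x 0 1

theorem mul_neg_mul (x y : EuclideanSpace ℝ (Fin n)) : 𝔾.mul x (𝔾.mul (-x) y) = y := by
  rw [← 𝔾.mul_assoc, 𝔾.mul_neg_self, 𝔾.zero_mul]

theorem contDiff_uncurry_mul {k : WithTop ℕ∞} : ContDiff ℝ k (Function.uncurry 𝔾.mul) := by
  obtain ⟨p, hp⟩ := 𝔾.mul_polynomial
  rw [contDiff_euclidean]
  intro i
  let L : EuclideanSpace ℝ (Fin n) × EuclideanSpace ℝ (Fin n) →ₗ[ℝ] (Fin n ⊕ Fin n → ℝ) :=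
    { toFun := fun z => Sum.elim (fun j => z.1 j) (fun j => z.2 j)
      map_add' := fun a b => by ext (j | j) <;> simp
      map_smul' := fun c a => by ext (j | j) <;> simp }
  have h := (AnalyticOnNhd.eval_linearMap L.toContinuousLinearMap.toLinearMap (p i)).contDiff
    (n := k)
  exact (funext fun z => hp z.1 z.2 i :
    (fun z => Function.uncurry 𝔾.mul z i) = fun z => MvPolynomial.eval (L z) (p i)) ▸ h

theorem contDiff_mul_left {k : WithTop ℕ∞} (x : EuclideanSpace ℝ (Fin n)) :
    ContDiff ℝ k (𝔾.mul x) :=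
  𝔾.contDiff_uncurry_mul.comp (contDiff_prodMk_right x)

theorem continuous_frame (i : Fin n) : Continuous (fun x => 𝔾.frame x i) :=
  (ContDiff.fderiv_apply (n := 0) (m := 1) (f := 𝔾.mul) (g := fun _ => 0)
    (k := fun _ => EuclideanSpace.single i (1 : ℝ)) 𝔾.contDiff_uncurry_mul contDiff_const
    contDiff_const le_rfl).continuous

/-- The dilation `δ_t` as a continuous linear map. -/
noncomputable def dilationCLM (t : ℝ) : EuclideanSpace ℝ (Fin n) →L[ℝ] EuclideanSpace ℝ (Fin n) :=
  LinearMap.toContinuousLinearMap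
    { toFun := 𝔾.dilation t
      map_add' := fun x y => by ext i; simp [dilation, mul_add]
      map_smul' := fun c x => by ext i; simp [dilation, mul_left_comm] }

@[simp]
theorem dilationCLM_apply (t : ℝ) (x : EuclideanSpace ℝ (Fin n)) :
    𝔾.dilationCLM t x = 𝔾.dilation t x := rfl

theorem dilation_single (t : ℝ) (i : 𝔾.HIdx) :
    𝔾.dilation t (EuclideanSpace.single i.1 (1 : ℝ)) =
      t • EuclideanSpace.single i.1 (1 : ℝ) := by
  ext j
  by_cases h : j = i.1
  · subst h; simp [dilation, i.2]
  · simp [dilation, h]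

theorem dilation_zero_left (x : EuclideanSpace ℝ (Fin n)) : 𝔾.dilation 0 x = 0 := by
  ext i
  have := 𝔾.one_le_ord i
  simp [dilation, show 𝔾.ord i ≠ 0 by omega]

theorem dilation_zero_right (t : ℝ) : 𝔾.dilation t 0 = 0 := map_zero (𝔾.dilationCLM t)

theorem dilation_one (x : EuclideanSpace ℝ (Fin n)) : 𝔾.dilation 1 x = x := by
  ext i; simp [dilation]

theorem dilation_dilation (s t : ℝ) (x : EuclideanSpace ℝ (Fin n)) :
    𝔾.dilation s (𝔾.dilation t x) = 𝔾.dilation (s * t) x := by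
  ext i; simp [dilation, mul_pow, _root_.mul_assoc]

theorem continuous_dilation_left (x : EuclideanSpace ℝ (Fin n)) :
    Continuous (fun t => 𝔾.dilation t x) := by
  unfold dilation; fun_prop

theorem continuous_gradH {η : EuclideanSpace ℝ (Fin n) → ℝ} (hη : ContDiff ℝ 1 η) :
    Continuous (𝔾.gradH η) := by
  have h : ∀ i : 𝔾.HIdx, Continuous fun y => fderiv ℝ η y (𝔾.frame y i) := fun i =>
    (hη.continuous_fderiv one_ne_zero).clm_apply (𝔾.continuous_frame i)
  unfold gradH
  fun_prop

theorem gradH_mul {η ζ : EuclideanSpace ℝ (Fin n) → ℝ} (hη : ContDiff ℝ 1 η)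
    (hζ : ContDiff ℝ 1 ζ) (y : EuclideanSpace ℝ (Fin n)) :
    𝔾.gradH (fun z => η z * ζ z) y = η y • 𝔾.gradH ζ y + ζ y • 𝔾.gradH η y := by
  ext i
  simp [gradH, fderiv_fun_mul (hη.differentiable one_ne_zero y) (hζ.differentiable one_ne_zero y)]

/-- The horizontal gradient commutes with left translations and scales by `t` under `δ_t`, as the
horizontal frame is left-invariant and homogeneous of degree one. -/
theorem gradH_comp_dilation_mul {χ : EuclideanSpace ℝ (Fin n) → ℝ} (hχ : ContDiff ℝ 1 χ)
    (x y : EuclideanSpace ℝ (Fin n)) {t : ℝ} (ht : 0 < t) :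
    𝔾.gradH (fun z => χ (𝔾.dilation t (𝔾.mul x z))) y =
      t • 𝔾.gradH χ (𝔾.dilation t (𝔾.mul x y)) := by
  set z := 𝔾.dilation t (𝔾.mul x y)
  have hdil : ContDiff ℝ 1 (𝔾.dilation t) := (𝔾.dilationCLM t).contDiff
  have hζ : ContDiff ℝ 1 (fun z => χ (𝔾.dilation t (𝔾.mul x z))) :=
    hχ.comp (hdil.comp (𝔾.contDiff_mul_left x))
  ext i
  simp only [gradH, frame, PiLp.smul_apply, smul_eq_mul]
  -- Both sides are derivatives at `0` of one function, as left translations and dilations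
  -- are compatible with the group law.
  have key : (fun v => χ (𝔾.dilation t (𝔾.mul x (𝔾.mul y v)))) =
      fun v => χ (𝔾.mul z (𝔾.dilationCLM t v)) := by
    funext v
    rw [← 𝔾.mul_assoc]
    exact congrArg χ (𝔾.dilation_mul t _ _ ht)
  have h1 : HasFDerivAt (fun v => χ (𝔾.dilation t (𝔾.mul x (𝔾.mul y v))))
      ((fderiv ℝ (fun z => χ (𝔾.dilation t (𝔾.mul x z))) y).comp (fderiv ℝ (𝔾.mul y) 0)) 0 := by
    refine HasFDerivAt.comp (g := fun z => χ (𝔾.dilation t (𝔾.mul x z))) (f := 𝔾.mul y) 0 ?_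
      ((𝔾.contDiff_mul_left (k := 1) y).differentiable one_ne_zero 0).hasFDerivAt
    rw [𝔾.mul_zero]
    exact (hζ.differentiable one_ne_zero y).hasFDerivAt
  have h2 : HasFDerivAt (fun v => χ (𝔾.mul z (𝔾.dilationCLM t v)))
      ((fderiv ℝ χ z).comp ((fderiv ℝ (𝔾.mul z) 0).comp (𝔾.dilationCLM t))) 0 := by
    refine HasFDerivAt.comp (g := χ) (f := fun v => 𝔾.mul z (𝔾.dilationCLM t v)) 0 ?_ ?_
    · rw [map_zero, 𝔾.mul_zero]
      exact (hχ.differentiable one_ne_zero z).hasFDerivAt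
    · refine HasFDerivAt.comp (g := 𝔾.mul z) (f := 𝔾.dilationCLM t) 0 ?_
        (𝔾.dilationCLM t).hasFDerivAt
      rw [map_zero]
      exact ((𝔾.contDiff_mul_left (k := 1) z).differentiable one_ne_zero 0).hasFDerivAt
  rw [key] at h1
  have h3 := congrArg (fun A => A (EuclideanSpace.single i.1 (1 : ℝ))) (h1.unique h2)
  simpa [𝔾.dilation_single] using h3

/-! ### Homogeneous balls and cutoff functions -/

namespace HomogeneousDistance

variable {𝔾} (ϱ : 𝔾.HomogeneousDistance)

theorem continuous_left (x : EuclideanSpace ℝ (Fin n)) : Continuous (ϱ.dist x) :=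
  ϱ.continuous.comp (Continuous.prodMk_right x)

theorem dist_zero_dilation {t : ℝ} (ht : 0 ≤ t) (y : EuclideanSpace ℝ (Fin n)) :
    ϱ.dist 0 (𝔾.dilation t y) = t * ϱ.dist 0 y := by
  simpa [𝔾.dilation_zero_right] using ϱ.homogeneous t 0 y ht

theorem dist_eq_dist_zero (x y : EuclideanSpace ℝ (Fin n)) :
    ϱ.dist x y = ϱ.dist 0 (𝔾.mul (-x) y) := by
  rw [← ϱ.left_invariant x y (-x), 𝔾.neg_mul_self]

theorem dist_zero_pos {y : EuclideanSpace ℝ (Fin n)} (hy : y ≠ 0) : 0 < ϱ.dist 0 y :=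
  (ϱ.nonneg 0 y).lt_of_ne fun h => hy ((ϱ.eq_zero_iff 0 y).1 h.symm).symm

/-- Small homogeneous balls about the identity are bounded: the distance to the identity is bounded
below on the Euclidean unit sphere, and a contracting dilation moves each point outside it onto the
sphere. -/
theorem exists_pos_forall_dist_zero_le_norm_lt :
    ∃ m : ℝ, 0 < m ∧ ∀ y, ϱ.dist 0 y ≤ m → ‖y‖ < 1 := by
  have hc : IsCompact (Metric.sphere (0 : EuclideanSpace ℝ (Fin n)) 1) := isCompact_sphere 0 1
  obtain ⟨m, hm, hms⟩ : ∃ m : ℝ, 0 < m ∧ ∀ y ∈ Metric.sphere (0 : EuclideanSpace ℝ (Fin n)) 1,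
      m < ϱ.dist 0 y := by
    rcases (Metric.sphere (0 : EuclideanSpace ℝ (Fin n)) 1).eq_empty_or_nonempty with he | hne
    · exact ⟨1, one_pos, by simp [he]⟩
    · obtain ⟨z, hz, hmin⟩ := hc.exists_isMinOn hne (ϱ.continuous_left 0).continuousOn
      have hz0 : 0 < ϱ.dist 0 z := ϱ.dist_zero_pos (by rintro rfl; simp at hz)
      exact ⟨ϱ.dist 0 z / 2, by positivity, fun y hy => by
        have : ϱ.dist 0 z ≤ ϱ.dist 0 y := hmin hy
        linarith⟩
  refine ⟨m, hm, fun y hy => ?_⟩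
  by_contra! h
  obtain ⟨t, ht, hty⟩ := intermediate_value_Icc (f := fun t => ‖𝔾.dilation t y‖) zero_le_one
    (𝔾.continuous_dilation_left y).norm.continuousOn
    (show (1 : ℝ) ∈ _ by simpa [𝔾.dilation_zero_left, 𝔾.dilation_one] using h)
  have h1 := hms (𝔾.dilation t y) (by simpa using hty)
  rw [ϱ.dist_zero_dilation ht.1] at h1
  nlinarith [ϱ.nonneg 0 y, ht.2]

theorem isClosed_setOf_dist_le (x : EuclideanSpace ℝ (Fin n)) (r : ℝ) :
    IsClosed {y | ϱ.dist x y ≤ r} :=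
  isClosed_le (ϱ.continuous_left x) continuous_const

theorem isOpen_ball (x : EuclideanSpace ℝ (Fin n)) (r : ℝ) : IsOpen (ϱ.ball x r) :=
  isOpen_lt (ϱ.continuous_left x) continuous_const

theorem isCompact_setOf_dist_zero_le (r : ℝ) : IsCompact {y | ϱ.dist 0 y ≤ r} := by
  obtain ⟨m, hm, h⟩ := ϱ.exists_pos_forall_dist_zero_le_norm_lt
  set s : ℝ := m / (|r| + 1) with hs
  have hr1 : 0 < |r| + 1 := by positivity
  have hs0 : 0 < s := by positivity
  refine ((isCompact_closedBall (0 : EuclideanSpace ℝ (Fin n)) 1).image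
    (𝔾.dilationCLM s⁻¹).continuous).of_isClosed_subset (ϱ.isClosed_setOf_dist_le 0 r) ?_
  intro y hy
  refine ⟨𝔾.dilation s y, ?_, ?_⟩
  · rw [mem_closedBall_zero_iff]
    refine (h _ ?_).le
    rw [ϱ.dist_zero_dilation hs0.le, hs, div_mul_eq_mul_div, div_le_iff₀ hr1]
    have : ϱ.dist 0 y ≤ |r| + 1 := (show ϱ.dist 0 y ≤ r from hy).trans (by linarith [le_abs_self r])
    gcongr
  · rw [dilationCLM_apply, 𝔾.dilation_dilation, inv_mul_cancel₀ hs0.ne', 𝔾.dilation_one]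

/-- A homogeneous distance induces the Euclidean topology. -/
theorem exists_setOf_dist_le_subset {x : EuclideanSpace ℝ (Fin n)}
    {V : Set (EuclideanSpace ℝ (Fin n))} (hV : IsOpen V) (hx : x ∈ V) :
    ∃ r : ℝ, 0 < r ∧ {y | ϱ.dist x y ≤ r} ⊆ V := by
  set W := 𝔾.mul x ⁻¹' V
  have hW : IsOpen W := hV.preimage (𝔾.contDiff_mul_left (k := 0) x).continuous
  have h0W : (0 : EuclideanSpace ℝ (Fin n)) ∈ W := by simpa [W, 𝔾.mul_zero] using hx
  have hc : IsCompact ({y | ϱ.dist 0 y ≤ 1} \ W) := (ϱ.isCompact_setOf_dist_zero_le 1).diff hW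
  obtain ⟨r, hr, hr1, hrW⟩ : ∃ r : ℝ, 0 < r ∧ r ≤ 1 ∧ ∀ z, ϱ.dist 0 z ≤ r → z ∈ W := by
    rcases ({y | ϱ.dist 0 y ≤ 1} \ W).eq_empty_or_nonempty with he | hne
    · exact ⟨1, one_pos, le_rfl, fun z hz => by
        by_contra h
        exact (he.subset ⟨hz, h⟩ : z ∈ (∅ : Set _))⟩
    · obtain ⟨z, hz, hmin⟩ := hc.exists_isMinOn hne (ϱ.continuous_left 0).continuousOn
      have hz0 : 0 < ϱ.dist 0 z := ϱ.dist_zero_pos (by rintro rfl; exact hz.2 h0W)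
      have hz1 : ϱ.dist 0 z ≤ 1 := hz.1
      refine ⟨ϱ.dist 0 z / 2, by positivity, by linarith, fun y hy => ?_⟩
      by_contra h
      have : ϱ.dist 0 z ≤ ϱ.dist 0 y := hmin ⟨show ϱ.dist 0 y ≤ 1 by linarith, h⟩
      linarith
  refine ⟨r, hr, fun y hy => ?_⟩
  have := hrW (𝔾.mul (-x) y) (by rw [← ϱ.dist_eq_dist_zero]; exact hy)
  simpa [W, 𝔾.mul_neg_mul] using this

/-- Cutoff functions between concentric balls, with a gradient bound that is uniform in the
center and inversely proportional to the radius: left translates and dilates of a single bump. -/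
theorem exists_cutoff : ∃ M : ℝ, ∀ (x : EuclideanSpace ℝ (Fin n)) (R : ℝ), 0 < R →
    ∃ ζ : EuclideanSpace ℝ (Fin n) → ℝ, ContDiff ℝ 1 ζ ∧ (∀ y, 0 ≤ ζ y ∧ ζ y ≤ 1) ∧
      (∀ y, ϱ.dist x y ≤ R / 2 → ζ y = 1) ∧ (∀ y, 3 / 4 * R < ϱ.dist x y → ζ y = 0) ∧
      ∀ y, ‖𝔾.gradH ζ y‖ ≤ M / R := by
  have hsub : {y | ϱ.dist 0 y ≤ 1 / 2} ⊆ interior {y | ϱ.dist 0 y ≤ 3 / 4} := by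
    refine Subset.trans (fun y hy => ?_) (interior_maximal (s := {y | ϱ.dist 0 y ≤ 3 / 4})
      (t := ϱ.ball 0 (3 / 4)) (fun y hy => le_of_lt (show ϱ.dist 0 y < 3 / 4 from hy))
      (ϱ.isOpen_ball 0 (3 / 4)))
    have : ϱ.dist 0 y ≤ 1 / 2 := hy
    exact show ϱ.dist 0 y < 3 / 4 by linarith
  obtain ⟨χ, hχ1, hχ0, hχ⟩ := exists_contMDiffMap_one_nhds_of_subset_interior
    (modelWithCornersSelf ℝ (EuclideanSpace ℝ (Fin n))) (n := 1)
    (ϱ.isClosed_setOf_dist_le 0 (1 / 2)) hsub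
  have hχd : ContDiff ℝ 1 χ := χ.contMDiff.contDiff
  obtain ⟨M, hM⟩ := (ϱ.isCompact_setOf_dist_zero_le (3 / 4)).exists_bound_of_continuousOn
    (𝔾.continuous_gradH hχd).continuousOn
  -- Where `χ` vanishes it attains its minimum, so that its gradient vanishes.
  have hbound : ∀ y, ‖𝔾.gradH χ y‖ ≤ |M| := by
    intro y
    by_cases hy : ϱ.dist 0 y ≤ 3 / 4
    · exact (hM y hy).trans (le_abs_self M)
    · have hmin : IsLocalMin χ y :=
        Eventually.of_forall fun z => by rw [hχ0 y hy]; exact (hχ z).1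
      have : 𝔾.gradH χ y = 0 := by ext i; simp [gradH, hmin.fderiv_eq_zero]
      simp [this]
  refine ⟨|M|, fun x R hR => ?_⟩
  have hdist : ∀ y, ϱ.dist 0 (𝔾.dilation R⁻¹ (𝔾.mul (-x) y)) = R⁻¹ * ϱ.dist x y := fun y => by
    rw [ϱ.dist_zero_dilation (inv_nonneg.2 hR.le), ← ϱ.dist_eq_dist_zero]
  refine ⟨fun y => χ (𝔾.dilation R⁻¹ (𝔾.mul (-x) y)), ?_, fun y => hχ _, fun y hy => ?_,
    fun y hy => ?_, fun y => ?_⟩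
  · exact hχd.comp ((𝔾.dilationCLM R⁻¹).contDiff.comp (𝔾.contDiff_mul_left (-x)))
  · refine hχ1.self_of_nhdsSet _ ?_
    rw [mem_ofPred_eq, hdist, inv_mul_le_iff₀ hR]
    linarith
  · refine hχ0 _ ?_
    rw [mem_ofPred_eq, hdist, not_le, lt_inv_mul_iff₀ hR]
    linarith
  · rw [𝔾.gradH_comp_dilation_mul hχd _ _ (inv_pos.2 hR), norm_smul, Real.norm_of_nonneg
      (inv_nonneg.2 hR.le), div_eq_inv_mul]
    exact mul_le_mul_of_nonneg_left (hbound _) (inv_nonneg.2 hR.le)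

end HomogeneousDistance

end CarnotGroup

/-! ### Local finiteness of the `H`-perimeter -/

/-- The zero set of a function has finite Hausdorff measure of codimension one near a regular
point: there the orthogonal projection to the kernel of the derivative, restricted to the zero set,
is antilipschitz. -/
theorem exists_isOpen_hausdorffMeasure_lt_top {E : Type*} [NormedAddCommGroup E]
    [InnerProductSpace ℝ E] [FiniteDimensional ℝ E] [MeasurableSpace E] [BorelSpace E]
    {f : E → ℝ} {f' : E →L[ℝ] ℝ} {x : E} (hf : HasStrictFDerivAt f f' x) (hf' : f' ≠ 0) :
    ∃ V, IsOpen V ∧ x ∈ V ∧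
      Measure.hausdorffMeasure (Module.finrank ℝ E - 1 : ℕ) ({y | f y = 0} ∩ V) < ∞ := by
  set F := f'.ker
  have hrank : Module.finrank ℝ F = Module.finrank ℝ E - 1 := by
    have h1 := LinearMap.finrank_range_add_finrank_ker f'.toLinearMap
    have h2 : LinearMap.range f'.toLinearMap = ⊤ := LinearMap.range_eq_top.2
      (LinearMap.surjective fun h => hf' (ContinuousLinearMap.coe_inj.1 h))
    rw [h2, finrank_top, Module.finrank_self] at h1
    change _ + Module.finrank ℝ F = _ at h1
    omega
  let P : E →L[ℝ] F := F.orthogonalProjectionOnto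
  let Φ : E →L[ℝ] ℝ × F := f'.prod P
  have hΦ : LinearMap.ker Φ.toLinearMap = ⊥ := by
    refine LinearMap.ker_eq_bot'.2 fun w hw => ?_
    have h1 : f' w = 0 := congrArg Prod.fst hw
    have h2 : P w = 0 := congrArg Prod.snd hw
    have h3 := F.orthogonalProjectionOnto_mem_subspace_eq_self ⟨w, h1⟩
    exact congrArg Subtype.val (h3.symm.trans h2)
  obtain ⟨K, hK0, hK⟩ := Φ.toLinearMap.exists_antilipschitzWith hΦ
  have hKle : ∀ w, ‖w‖ ≤ K * max ‖f' w‖ ‖P w‖ := fun w => by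
    have := hK.le_mul_dist w 0
    rwa [map_zero, dist_zero_right, dist_zero_right] at this
  have hK0' : (0 : ℝ) < K := hK0
  obtain ⟨V, hV, hVf⟩ := (hf.isLittleO.def (c := (2 * K : ℝ)⁻¹) (by positivity)).exists_mem
  rw [nhds_prod_eq, mem_prod_self_iff] at hV
  obtain ⟨W, hW, hWV⟩ := hV
  refine ⟨interior W ∩ Metric.ball x 1, isOpen_interior.inter Metric.isOpen_ball,
    ⟨mem_interior_iff_mem_nhds.2 hW, Metric.mem_ball_self one_pos⟩, ?_⟩
  set T := {y | f y = 0} ∩ (interior W ∩ Metric.ball x 1)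
  have hanti : AntilipschitzWith K (fun y : T => P y) := by
    refine AntilipschitzWith.of_le_mul_dist fun y z => ?_
    have h1 := hVf (y.1, z.1) (hWV ⟨interior_subset y.2.2.1, interior_subset z.2.2.1⟩)
    have hy : f y = 0 := y.2.1
    have hz : f z = 0 := z.2.1
    simp only [hy, hz, sub_self, zero_sub, norm_neg] at h1
    have h2 := hKle (y.1 - z.1)
    rw [Subtype.dist_eq, dist_eq_norm, dist_eq_norm, ← map_sub]
    rcases le_total ‖f' (y.1 - z.1)‖ ‖P (y.1 - z.1)‖ with h | h
    · rwa [max_eq_right h] at h2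
    · rw [max_eq_left h] at h2
      have h3 : ‖y.1 - z.1‖ ≤ K * ((2 * K : ℝ)⁻¹ * ‖y.1 - z.1‖) :=
        h2.trans (mul_le_mul_of_nonneg_left h1 hK0'.le)
      have h4 : (K : ℝ) * ((2 * K : ℝ)⁻¹ * ‖y.1 - z.1‖) = ‖y.1 - z.1‖ / 2 := by
        field_simp
      have h5 : ‖y.1 - z.1‖ ≤ 0 := by linarith
      exact h5.trans (by positivity)
  have h1 := hanti.le_hausdorffMeasure_image (Nat.cast_nonneg (Module.finrank ℝ E - 1)) univ
  have h2 : Measure.hausdorffMeasure (Module.finrank ℝ E - 1 : ℕ) (univ : Set T) =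
      Measure.hausdorffMeasure (Module.finrank ℝ E - 1 : ℕ) T := by
    rw [← isometry_subtype_coe.hausdorffMeasure_image (Or.inl (Nat.cast_nonneg _)), image_univ,
      Subtype.range_coe]
  rw [← h2]
  refine h1.trans_lt (ENNReal.mul_lt_top (by finiteness) ?_)
  refine (measure_mono (t := Metric.closedBall (P x) ‖P‖) ?_).trans_lt ?_
  · rintro _ ⟨y, -, rfl⟩
    rw [Metric.mem_closedBall, dist_eq_norm, ← map_sub]
    refine (P.le_opNorm _).trans (mul_le_of_le_one_right (norm_nonneg _) ?_)
    rw [← dist_eq_norm]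
    exact (Metric.mem_ball.1 y.2.2.2).le
  · rw [← hrank]
    exact (isCompact_closedBall _ _).measure_lt_top

namespace CarnotGroup

variable {n : ℕ} (𝔾 : CarnotGroup n)

theorem hNormalLength_le (S : Set (EuclideanSpace ℝ (Fin n))) (y : EuclideanSpace ℝ (Fin n)) :
    𝔾.hNormalLength S y ≤ Real.sqrt (∑ i : 𝔾.HIdx, ‖𝔾.frame y i‖ ^ 2) := by
  unfold hNormalLength
  gcongr
  exact Submodule.norm_starProjection_apply_le _ _

theorem hPerimeter_lt_top {S A : Set (EuclideanSpace ℝ (Fin n))} (hA : IsCompact A)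
    (h : μHE[n - 1] (A ∩ S) < ∞) : 𝔾.hPerimeter S A < ∞ := by
  have hframe := 𝔾.continuous_frame
  obtain ⟨C, hC⟩ := hA.exists_bound_of_continuousOn
    (f := fun y => Real.sqrt (∑ i : 𝔾.HIdx, ‖𝔾.frame y i‖ ^ 2))
    (Continuous.continuousOn (by fun_prop))
  rw [hPerimeter, withDensity_apply _ hA.measurableSet]
  calc ∫⁻ y in A, ENNReal.ofReal (𝔾.hNormalLength S y) ∂(μHE[n - 1].restrict S)
      ≤ ∫⁻ _ in A, ENNReal.ofReal C ∂(μHE[n - 1].restrict S) := by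
        refine setLIntegral_mono measurable_const fun y hy => ENNReal.ofReal_le_ofReal ?_
        exact (𝔾.hNormalLength_le S y).trans ((le_abs_self _).trans (hC y hy))
    _ < ∞ := by
        rw [setLIntegral_const, Measure.restrict_apply hA.measurableSet]
        exact ENNReal.mul_lt_top ENNReal.ofReal_lt_top h

theorem hPerimeter_eq_zero_of_disjoint {S A : Set (EuclideanSpace ℝ (Fin n))}
    (hA : MeasurableSet A) (h : Disjoint A S) : 𝔾.hPerimeter S A = 0 := by
  refine withDensity_absolutelyContinuous _ _ ?_
  rw [Measure.restrict_apply hA, h.inter_eq, measure_empty]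

/-- Near each of its points a hypersurface is relatively closed and has finite `H`-perimeter. -/
theorem exists_isOpen_isCompact_inter_hPerimeter_lt_top {S : Set (EuclideanSpace ℝ (Fin n))}
    (hS : IsC2Hypersurface S) {x : EuclideanSpace ℝ (Fin n)} (hx : x ∈ S) :
    ∃ V, IsOpen V ∧ x ∈ V ∧
      ∀ A ⊆ V, IsCompact A → IsCompact (S ∩ A) ∧ 𝔾.hPerimeter S A < ∞ := by
  obtain ⟨U, f, hU, hxU, hf, hf', hSU⟩ := hS x hx
  obtain ⟨V, hV, hxV, hfin⟩ := exists_isOpen_hausdorffMeasure_lt_top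
    ((hf.contDiffAt (hU.mem_nhds hxU)).hasStrictFDerivAt two_ne_zero) (hf' x hxU)
  refine ⟨U ∩ V, hU.inter hV, ⟨hxU, hxV⟩, fun A hAV hA => ⟨?_, 𝔾.hPerimeter_lt_top hA ?_⟩⟩
  · have : S ∩ A = A ∩ f ⁻¹' {0} := by
      ext y
      have := Set.ext_iff.1 hSU y
      simp only [mem_inter_iff, mem_ofPred_eq, mem_preimage, mem_singleton_iff] at this ⊢
      have h2 : y ∈ A → y ∈ U := fun h => (hAV h).1
      tauto
    rw [this]
    exact ((hf.continuousOn.mono fun y hy => (hAV hy).1).preimage_isClosed_of_isClosed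
      hA.isClosed isClosed_singleton) |> hA.of_isClosed_subset <| inter_subset_left
  · rw [finrank_euclideanSpace_fin] at hfin
    rw [Measure.euclideanHausdorffMeasure_def, Measure.smul_apply]
    refine ENNReal.mul_lt_top ENNReal.coe_lt_top ((measure_mono ?_).trans_lt hfin)
    exact fun y hy => ⟨(hSU.subset ⟨hy.2, (hAV hy.1).1⟩).2, (hAV hy.1).2⟩

end CarnotGroup

/-! ### Energy estimate with a cutoff function -/

section

variable {E F : Type*} [MeasurableSpace E] [NormedAddCommGroup F] {μ : Measure E} {K U : Set E}

theorem MeasureTheory.MemLp.continuous_smul [TopologicalSpace E] [T2Space E]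
    [BorelSpace E] [NormedSpace ℝ F] {p : ℝ≥0∞} {G : E → F}
    (hG : MemLp G p (μ.restrict K)) (hK : IsCompact K) {g : E → ℝ} (hg : Continuous g) :
    MemLp (fun y => g y • G y) p (μ.restrict K) := by
  obtain ⟨C, hC⟩ := hK.exists_bound_of_continuousOn hg.continuousOn
  refine hG.of_le_mul (c := C) (hg.aestronglyMeasurable.smul hG.1) ?_
  filter_upwards [ae_restrict_mem hK.measurableSet] with y hy
  rw [norm_smul]
  exact mul_le_mul_of_nonneg_right (hC y hy) (norm_nonneg _)

theorem MeasureTheory.MemLp.inner_continuous [TopologicalSpace E] [T2Space E]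
    [SecondCountableTopology E] [BorelSpace E] [InnerProductSpace ℝ F] {p : ℝ≥0∞} {G : E → F}
    (hG : MemLp G p (μ.restrict K)) (hK : IsCompact K) {V : E → F}
    (hV : Continuous V) : MemLp (fun y => inner ℝ (G y) (V y)) p (μ.restrict K) := by
  obtain ⟨C, hC⟩ := hK.exists_bound_of_continuousOn hV.continuousOn
  have hVm : AEStronglyMeasurable V (μ.restrict K) := hV.aestronglyMeasurable
  refine hG.of_le_mul (c := C) (hG.1.inner (𝕜 := ℝ) hVm) ?_
  filter_upwards [ae_restrict_mem hK.measurableSet] with y hy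
  refine (norm_inner_le_norm _ _).trans ?_
  rw [mul_comm]
  exact mul_le_mul_of_nonneg_right (hC y hy) (norm_nonneg _)

theorem MeasureTheory.MemLp.of_ae_eq_zero_off {p : ℝ≥0∞} {G : E → F}
    (hG : MemLp G p (μ.restrict K)) (hK : MeasurableSet K) (hKU : K ⊆ U)
    (h : ∀ᵐ y ∂(μ.restrict U), y ∉ K → G y = 0) : MemLp G p (μ.restrict U) := by
  have h1 : MemLp (K.indicator G) p (μ.restrict U) := by
    rwa [memLp_indicator_iff_restrict hK, Measure.restrict_restrict hK,
      inter_eq_self_of_subset_left hKU]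
  refine h1.ae_eq ?_
  filter_upwards [h] with y hy
  by_cases hyK : y ∈ K
  · simp [hyK]
  · simp [hyK, hy hyK]

end

namespace CarnotGroup

variable {n : ℕ} (𝔾 : CarnotGroup n)

/-- Against fields tangent to `HS`, the tangential gradient may be replaced by `grad_H`, which is
continuous; no regularity of `y ↦ HS S y` is needed. -/
theorem inner_gradHS_of_mem {S : Set (EuclideanSpace ℝ (Fin n))}
    {y : EuclideanSpace ℝ (Fin n)} {v : 𝔾.HVec} (hv : v ∈ 𝔾.HS S y)
    (η : EuclideanSpace ℝ (Fin n) → ℝ) :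
    inner ℝ v (𝔾.gradHS S η y) = inner ℝ v (𝔾.gradH η y) := by
  rw [gradHS, ← Submodule.inner_starProjection_left_eq_right,
    Submodule.starProjection_eq_self_iff.2 hv]

/-- If `G` is tangent to `HS` with `𝓓_HS G = -ψ`, then for a cutoff `ζ` the field `ζ² G` has
divergence `2 ζ ⟨G, grad ζ⟩ - ζ² ψ`, by the product rule on test functions. -/
theorem isDistribDHS_sq_smul {S U K : Set (EuclideanSpace ℝ (Fin n))}
    {G : EuclideanSpace ℝ (Fin n) → 𝔾.HVec} {ψ ζ : EuclideanSpace ℝ (Fin n) → ℝ}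
    (hUS : ∀ᵐ y ∂((𝔾.hPerimeter S).restrict U), y ∈ S) (hK : IsCompact K) (hKU : K ⊆ S ∩ U)
    (hKfin : 𝔾.hPerimeter S K < ∞) (hζ : ContDiff ℝ 1 ζ) (hζK : ∀ y ∈ S \ K, ζ y = 0)
    (hG : MemLp G 2 ((𝔾.hPerimeter S).restrict K)) (hGS : 𝔾.IsHSField S U G)
    (hψ : MemLp ψ 2 ((𝔾.hPerimeter S).restrict K))
    (hD : 𝔾.IsDistribDHS S U G (fun y => -ψ y)) :
    𝔾.IsDistribDHS S U (fun y => ζ y ^ 2 • G y)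
      (fun y => 2 * ζ y * inner ℝ (G y) (𝔾.gradH ζ y) - ζ y ^ 2 * ψ y) := by
  intro η hη
  have hη1 : ContDiff ℝ 1 η := hη.1
  have : IsFiniteMeasure ((𝔾.hPerimeter S).restrict K) := ⟨by simpa using hKfin⟩
  have hζc := hζ.continuous
  have hηc := hη1.continuous
  have hgζ := 𝔾.continuous_gradH hζ
  have hgη := 𝔾.continuous_gradH hη1
  have hoff : ∀ᵐ y ∂((𝔾.hPerimeter S).restrict U), y ∉ K → ζ y = 0 := by
    filter_upwards [hUS] with y hy hyK using hζK y ⟨hy, hyK⟩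
  have hint : ∀ {g : EuclideanSpace ℝ (Fin n) → ℝ},
      MemLp g 2 ((𝔾.hPerimeter S).restrict K) → (∀ y, ζ y = 0 → g y = 0) →
      Integrable g ((𝔾.hPerimeter S).restrict U) := fun {g} hg h0 =>
    memLp_one_iff_integrable.1 <| (hg.mono_exponent one_le_two).of_ae_eq_zero_off hK.measurableSet
      (fun y hy => (hKU hy).2) (hoff.mono fun y hy hyK => h0 y (hy hyK))
  have h1 : Integrable (fun y => inner ℝ (G y) (ζ y ^ 2 • 𝔾.gradH η y))
      ((𝔾.hPerimeter S).restrict U) :=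
    hint (hG.inner_continuous hK ((hζc.pow 2).smul hgη)) fun y hy => by simp [hy]
  have h2 : Integrable (fun y => inner ℝ (G y) ((2 * ζ y * η y) • 𝔾.gradH ζ y))
      ((𝔾.hPerimeter S).restrict U) :=
    hint (hG.inner_continuous hK (((continuous_const.mul hζc).mul hηc).smul hgζ))
      fun y hy => by simp [hy]
  have h3 : Integrable (fun y => (ζ y ^ 2 * η y) • ψ y) ((𝔾.hPerimeter S).restrict U) :=
    hint (hψ.continuous_smul hK ((hζc.pow 2).mul hηc)) fun y hy => by simp [hy]
  have hgrad : ∀ y, 𝔾.gradH (fun z => ζ z ^ 2 * η z) y =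
      ζ y ^ 2 • 𝔾.gradH η y + (2 * ζ y * η y) • 𝔾.gradH ζ y := fun y => by
    have hsq : 𝔾.gradH (fun z => ζ z ^ 2) y = (2 * ζ y) • 𝔾.gradH ζ y := by
      simp only [sq]
      rw [𝔾.gradH_mul hζ hζ, ← add_smul, two_mul]
    rw [𝔾.gradH_mul (hζ.pow 2) hη1, hsq, smul_smul]
    congr 2
    ring
  have hD' := hD (fun y => ζ y ^ 2 * η y)
    ⟨(hζ.pow 2).mul hη1, K, hK, hKU, fun y hy => by simp [hζK y hy]⟩
  have e1 : ∫ y in U, inner ℝ (G y) (𝔾.gradHS S (fun z => ζ z ^ 2 * η z) y) ∂(𝔾.hPerimeter S) =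
      ∫ y in U, inner ℝ (G y) (ζ y ^ 2 • 𝔾.gradH η y) ∂(𝔾.hPerimeter S) +
        ∫ y in U, inner ℝ (G y) ((2 * ζ y * η y) • 𝔾.gradH ζ y) ∂(𝔾.hPerimeter S) := by
    rw [← integral_add h1 h2]
    refine integral_congr_ae (hGS.mono fun y hy => ?_)
    simp only [𝔾.inner_gradHS_of_mem hy, hgrad, inner_add_right]
  have e2 : ∫ y in U, inner ℝ (ζ y ^ 2 • G y) (𝔾.gradHS S η y) ∂(𝔾.hPerimeter S) =
      ∫ y in U, inner ℝ (G y) (ζ y ^ 2 • 𝔾.gradH η y) ∂(𝔾.hPerimeter S) := by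
    refine integral_congr_ae (hGS.mono fun y hy => ?_)
    simp only [real_inner_smul_left, real_inner_smul_right, 𝔾.inner_gradHS_of_mem hy]
  have e3 : ∫ y in U, (2 * ζ y * inner ℝ (G y) (𝔾.gradH ζ y) - ζ y ^ 2 * ψ y) * η y
        ∂(𝔾.hPerimeter S) =
      ∫ y in U, inner ℝ (G y) ((2 * ζ y * η y) • 𝔾.gradH ζ y) ∂(𝔾.hPerimeter S) -
        ∫ y in U, (ζ y ^ 2 * η y) • ψ y ∂(𝔾.hPerimeter S) := by
    rw [← integral_sub h2 h3]
    refine integral_congr_ae (Eventually.of_forall fun y => ?_)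
    simp only [real_inner_smul_right, smul_eq_mul]
    ring
  have e4 : ∫ y in U, -ψ y * (ζ y ^ 2 * η y) ∂(𝔾.hPerimeter S) =
      -∫ y in U, (ζ y ^ 2 * η y) • ψ y ∂(𝔾.hPerimeter S) := by
    rw [← integral_neg]
    refine integral_congr_ae (Eventually.of_forall fun y => ?_)
    simp only [smul_eq_mul]
    ring
  rw [e1, e4, neg_neg] at hD'
  rw [e2, e3]
  linarith

/-- Young's inequality, with weights such that half of `‖z • G‖ ^ 2` remains to be absorbed. -/
theorem caccioppoli_pointwise {V : Type*} [NormedAddCommGroup V] [InnerProductSpace ℝ V]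
    {z φ ψ M R : ℝ} {G g : V} (hR : 0 < R) (hz0 : 0 ≤ z) (hz1 : z ≤ 1) (hg : ‖g‖ ≤ M / R) :
    -(φ * (2 * z * inner ℝ G g - z ^ 2 * ψ)) ≤
      1 / 2 * ‖z • G‖ ^ 2 +
        (1 + 4 * M ^ 2) / 2 * ((R ^ 2)⁻¹ * φ ^ 2 + R ^ 2 * ψ ^ 2) := by
  have hG := abs_real_inner_le_norm G g
  rw [norm_smul, Real.norm_of_nonneg hz0]
  have h1 : |inner ℝ G g| ≤ ‖G‖ * (M / R) := hG.trans (by gcongr)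
  have hM : 0 ≤ M / R := (norm_nonneg _).trans hg
  set a := |φ| / R with ha
  set b := R * |ψ| with hb
  set A := z * ‖G‖ with hA
  have ha2 : (R ^ 2)⁻¹ * φ ^ 2 = a ^ 2 := by rw [ha, div_pow, sq_abs]; field_simp
  have hb2 : R ^ 2 * ψ ^ 2 = b ^ 2 := by rw [hb, mul_pow, sq_abs]
  have h2 : -(φ * (2 * z * inner ℝ G g - z ^ 2 * ψ)) ≤ 2 * (A * (a * M)) + a * b := by
    have t1 : -(φ * (2 * z * inner ℝ G g)) ≤ 2 * (A * (a * M)) := by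
      refine (neg_le_abs _).trans ?_
      rw [abs_mul, abs_mul, abs_mul, abs_of_nonneg hz0, abs_two]
      calc |φ| * (2 * z * |inner ℝ G g|) ≤ |φ| * (2 * z * (‖G‖ * (M / R))) := by gcongr
        _ = 2 * (A * (a * M)) := by rw [hA, ha]; field_simp
    have t2 : φ * (z ^ 2 * ψ) ≤ a * b := by
      refine (le_abs_self _).trans ?_
      rw [abs_mul, abs_mul, abs_of_nonneg (sq_nonneg z)]
      have hz2 : z ^ 2 ≤ 1 := pow_le_one₀ hz0 hz1
      calc |φ| * (z ^ 2 * |ψ|) ≤ |φ| * (1 * |ψ|) := by gcongr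
        _ = a * b := by rw [ha, hb]; field_simp
    linarith
  rw [ha2, hb2]
  nlinarith [sq_nonneg (A - 2 * (a * M)), sq_nonneg (a - b), mul_nonneg (sq_nonneg M) (sq_nonneg b)]

/-- The Caccioppoli estimate for a cutoff function `ζ`, with support (on `S`) in the compact set
`K`. -/
theorem lintegral_cutoff_smul_grad_le {S U K : Set (EuclideanSpace ℝ (Fin n))}
    {φ ψ ζ : EuclideanSpace ℝ (Fin n) → ℝ} {G : EuclideanSpace ℝ (Fin n) → 𝔾.HVec} {M R : ℝ}
    (hUS : ∀ᵐ y ∂((𝔾.hPerimeter S).restrict U), y ∈ S) (hK : IsCompact K) (hKU : K ⊆ S ∩ U)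
    (hKfin : 𝔾.hPerimeter S K < ∞) (hζ : ContDiff ℝ 1 ζ) (hζK : ∀ y ∈ S \ K, ζ y = 0)
    (hζ01 : ∀ y, 0 ≤ ζ y ∧ ζ y ≤ 1) (hR : 0 < R) (hM : ∀ y, ‖𝔾.gradH ζ y‖ ≤ M / R)
    (hψ : MemLp ψ 2 ((𝔾.hPerimeter S).restrict U)) (h : 𝔾.IsDistribSolution S U φ G ψ) (φ₀ : ℝ) :
    ∫⁻ y in U, ‖ζ y • G y‖ₑ ^ 2 ∂(𝔾.hPerimeter S) ≤
      ENNReal.ofReal (1 + 4 * M ^ 2) *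
        (ENNReal.ofReal (R ^ 2)⁻¹ * ∫⁻ y in U, ‖φ y - φ₀‖ₑ ^ 2 ∂(𝔾.hPerimeter S) +
          ENNReal.ofReal (R ^ 2) * ∫⁻ y in U, ‖ψ y‖ₑ ^ 2 ∂(𝔾.hPerimeter S)) := by
  obtain ⟨hw, hD⟩ := h
  set σ := 𝔾.hPerimeter S
  have : IsFiniteMeasure (σ.restrict K) := ⟨by simpa using hKfin⟩
  have hKU' : K ⊆ U := fun y hy => (hKU hy).2
  have hle : σ.restrict K ≤ σ.restrict U := Measure.restrict_mono hKU' le_rfl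
  have hG := hw.l2Loc_grad K hK hKU
  have hφ := hw.l2Loc K hK hKU
  have hψK : MemLp ψ 2 (σ.restrict K) := hψ.mono_measure hle
  have hφ₀ : MemLp (fun y => φ y - φ₀) 2 (σ.restrict K) := hφ.sub (memLp_const φ₀)
  have hζc := hζ.continuous
  have hgζ := 𝔾.continuous_gradH hζ
  have hoff : ∀ᵐ y ∂(σ.restrict U), y ∉ K → ζ y = 0 := by
    filter_upwards [hUS] with y hy hyK using hζK y ⟨hy, hyK⟩
  have htoK : ∀ {g : EuclideanSpace ℝ (Fin n) → ℝ}, (∀ y, ζ y = 0 → g y = 0) →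
      ∫ y in U, g y ∂σ = ∫ y in K, g y ∂σ := fun {g} h0 => by
    have e : g =ᵐ[σ.restrict U] K.indicator g := by
      filter_upwards [hoff] with y hy
      by_cases hyK : y ∈ K
      · simp [hyK]
      · simp [hyK, h0 y (hy hyK)]
    rw [integral_congr_ae e, integral_indicator hK.measurableSet,
      Measure.restrict_restrict hK.measurableSet, inter_eq_self_of_subset_left hKU']
  set f : EuclideanSpace ℝ (Fin n) → ℝ :=
    fun y => 2 * ζ y * inner ℝ (G y) (𝔾.gradH ζ y) - ζ y ^ 2 * ψ y with hfdef
  have hf0 : ∀ y, ζ y = 0 → f y = 0 := fun y hy => by simp [hfdef, hy]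
  have hI : MemLp (fun y => (2 * ζ y) • inner ℝ (G y) (𝔾.gradH ζ y)) 2 (σ.restrict K) :=
    (hG.inner_continuous hK hgζ).continuous_smul hK (continuous_const.mul hζc)
  have hJ : MemLp (fun y => ζ y ^ 2 • ψ y) 2 (σ.restrict K) := hψK.continuous_smul hK (hζc.pow 2)
  have hfK : MemLp f 2 (σ.restrict K) := hI.sub hJ
  have hXK : MemLp (fun y => ζ y ^ 2 • G y) 2 (σ.restrict K) := hG.continuous_smul hK (hζc.pow 2)
  have hζG : MemLp (fun y => ζ y • G y) 2 (σ.restrict K) := hG.continuous_smul hK hζc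
  have hint := hw.integral_eq (fun y => ζ y ^ 2 • G y) f K hK hKU
    (fun y hy => ⟨by simp [hζK y hy], hf0 y (hζK y hy)⟩)
    (hXK.of_ae_eq_zero_off hK.measurableSet hKU' (hoff.mono fun y hy hyK => by simp [hy hyK]))
    (hfK.of_ae_eq_zero_off hK.measurableSet hKU' (hoff.mono fun y hy hyK => hf0 y (hy hyK)))
    (hw.tangent.mono fun y hy => Submodule.smul_mem _ _ hy)
    (𝔾.isDistribDHS_sq_smul hUS hK hKU hKfin hζ hζK hG hw.tangent hψK hD)
  -- The divergence of the compactly supported field `ζ² G` has mean zero.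
  have hmean : ∫ y in K, f y ∂σ = 0 := by
    have hD' := hD (fun y => ζ y * ζ y)
      ⟨hζ.mul hζ, K, hK, hKU, fun y hy => by simp [hζK y hy]⟩
    have e1 : ∫ y in U, inner ℝ (G y) (𝔾.gradHS S (fun y => ζ y * ζ y) y) ∂σ =
        ∫ y in K, (2 * ζ y) • inner ℝ (G y) (𝔾.gradH ζ y) ∂σ := by
      rw [← htoK (fun y hy => by simp [hy])]
      refine integral_congr_ae (hw.tangent.mono fun y hy => ?_)
      simp only [𝔾.inner_gradHS_of_mem hy, 𝔾.gradH_mul hζ hζ, ← two_smul ℝ (ζ y • _),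
        real_inner_smul_right, smul_eq_mul, _root_.mul_assoc]
    have e2 : ∫ y in U, -ψ y * (ζ y * ζ y) ∂σ = -∫ y in K, ζ y ^ 2 • ψ y ∂σ := by
      rw [htoK (fun y hy => by simp [hy]), ← integral_neg]
      refine integral_congr_ae (Eventually.of_forall fun y => ?_)
      simp only [smul_eq_mul]
      ring
    rw [e1, e2, neg_neg] at hD'
    rw [← sub_eq_zero, ← integral_sub (hI.integrable one_le_two) (hJ.integrable one_le_two)] at hD'
    exact hD'
  have hφf : Integrable (fun y => φ y * f y) (σ.restrict K) := hφ.integrable_mul hfK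
  have hsq : ∀ {g : EuclideanSpace ℝ (Fin n) → ℝ}, MemLp g 2 (σ.restrict K) →
      Integrable (fun y => g y ^ 2) (σ.restrict K) := fun hg => hg.integrable_sq
  have hAint : Integrable (fun y => ‖ζ y • G y‖ ^ 2) (σ.restrict K) :=
    hζG.integrable_norm_pow two_ne_zero
  have hident : ∫ y in K, ‖ζ y • G y‖ ^ 2 ∂σ = ∫ y in K, -((φ y - φ₀) * f y) ∂σ := by
    have e1 : ∫ y in U, inner ℝ (G y) (ζ y ^ 2 • G y) ∂σ = ∫ y in K, ‖ζ y • G y‖ ^ 2 ∂σ := by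
      rw [htoK (fun y hy => by simp [hy])]
      refine integral_congr_ae (Eventually.of_forall fun y => ?_)
      simp only [real_inner_smul_right, real_inner_self_eq_norm_sq, norm_smul, mul_pow,
        Real.norm_eq_abs, sq_abs]
    have e2 : ∫ y in U, φ y * f y ∂σ = ∫ y in K, φ y * f y ∂σ :=
      htoK (fun y hy => by simp [hf0 y hy])
    have e3 : ∫ y in K, (φ y - φ₀) * f y ∂σ = ∫ y in K, φ y * f y ∂σ := by
      simp only [sub_mul]
      rw [integral_sub hφf ((hfK.integrable one_le_two).const_mul φ₀), integral_const_mul, hmean]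
      simp
    rw [integral_neg, e3, ← e2, ← e1, hint]
  set N : EuclideanSpace ℝ (Fin n) → ℝ :=
    fun y => (R ^ 2)⁻¹ * (φ y - φ₀) ^ 2 + R ^ 2 * ψ y ^ 2
  have hN : Integrable N (σ.restrict K) :=
    ((hsq hφ₀).const_mul _).add ((hsq hψK).const_mul _)
  have hreal : ∫ y in K, ‖ζ y • G y‖ ^ 2 ∂σ ≤ (1 + 4 * M ^ 2) * ∫ y in K, N y ∂σ := by
    have h1 : ∫ y in K, -((φ y - φ₀) * f y) ∂σ ≤
        ∫ y in K, (1 / 2 * ‖ζ y • G y‖ ^ 2 + (1 + 4 * M ^ 2) / 2 * N y) ∂σ :=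
      integral_mono (hφ₀.integrable_mul hfK).neg ((hAint.const_mul _).add (hN.const_mul _))
        fun y => caccioppoli_pointwise hR (hζ01 y).1 (hζ01 y).2 (hM y)
    rw [← hident, integral_add (hAint.const_mul _) (hN.const_mul _), integral_const_mul,
      integral_const_mul] at h1
    linarith
  have hlhs : ∫⁻ y in U, ‖ζ y • G y‖ₑ ^ 2 ∂σ = ENNReal.ofReal (∫ y in K, ‖ζ y • G y‖ ^ 2 ∂σ) := by
    have e : (fun y => ‖ζ y • G y‖ₑ ^ 2) =ᵐ[σ.restrict U]
        K.indicator fun y => ‖ζ y • G y‖ₑ ^ 2 := by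
      filter_upwards [hoff] with y hy
      by_cases hyK : y ∈ K
      · simp [hyK]
      · simp [hyK, hy hyK]
    rw [lintegral_congr_ae e, lintegral_indicator hK.measurableSet,
      Measure.restrict_restrict hK.measurableSet, inter_eq_self_of_subset_left hKU',
      ofReal_integral_eq_lintegral_ofReal hAint (Eventually.of_forall fun y => by positivity)]
    refine lintegral_congr fun y => ?_
    rw [ENNReal.ofReal_pow (norm_nonneg _), ofReal_norm]
  have hsqe : ∀ {g : EuclideanSpace ℝ (Fin n) → ℝ}, MemLp g 2 (σ.restrict K) →
      ENNReal.ofReal (∫ y in K, g y ^ 2 ∂σ) ≤ ∫⁻ y in U, ‖g y‖ₑ ^ 2 ∂σ := fun {g} hg => by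
    rw [ofReal_integral_eq_lintegral_ofReal (hsq hg) (Eventually.of_forall fun y => by positivity)]
    refine (lintegral_mono' hle le_rfl).trans (le_of_eq (lintegral_congr fun y => ?_))
    rw [← sq_abs, ENNReal.ofReal_pow (abs_nonneg _), ← Real.norm_eq_abs, ofReal_norm]
  rw [hlhs]
  refine (ENNReal.ofReal_le_ofReal hreal).trans ?_
  rw [ENNReal.ofReal_mul (by positivity)]
  refine mul_le_mul_right ?_ _
  rw [integral_add ((hsq hφ₀).const_mul _) ((hsq hψK).const_mul _), integral_const_mul,
    integral_const_mul]
  refine ENNReal.ofReal_add_le.trans ?_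
  rw [ENNReal.ofReal_mul (by positivity), ENNReal.ofReal_mul (by positivity)]
  exact add_le_add (mul_le_mul_right (hsqe hφ₀) _) (mul_le_mul_right (hsqe hψK) _)

end CarnotGroup

/-! ### The inequality on balls -/

theorem mainTheorem12 {n : ℕ} (𝔾 : CarnotGroup n) (ϱ : 𝔾.HomogeneousDistance) :
    ∃ C : ℝ≥0, 0 < C ∧
      ∀ S : Set (EuclideanSpace ℝ (Fin n)), IsC2Hypersurface S → ∀ x ∈ S,
      ∃ R₀ : ℝ, 0 < R₀ ∧ ∀ R : ℝ, 0 < R → R ≤ R₀ →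
      ∀ (φ ψ : EuclideanSpace ℝ (Fin n) → ℝ) (G : EuclideanSpace ℝ (Fin n) → 𝔾.HVec),
        MemLp ψ 2 ((𝔾.hPerimeter S).restrict (ϱ.ball x R)) →
        𝔾.IsDistribSolution S (ϱ.ball x R) φ G ψ →
        ∀ φ₀ : ℝ,
          ∫⁻ y in ϱ.ball x (R / 2), ‖G y‖ₑ ^ 2 ∂(𝔾.hPerimeter S) ≤
            (C : ℝ≥0∞) *
              (ENNReal.ofReal (R ^ 2)⁻¹ *
                  ∫⁻ y in ϱ.ball x R, ‖φ y - φ₀‖ₑ ^ 2 ∂(𝔾.hPerimeter S) +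
                ENNReal.ofReal (R ^ 2) *
                  ∫⁻ y in ϱ.ball x R, ‖ψ y‖ₑ ^ 2 ∂(𝔾.hPerimeter S)) := by
  obtain ⟨M, hcut⟩ := ϱ.exists_cutoff
  refine ⟨Real.toNNReal (1 + 4 * M ^ 2), Real.toNNReal_pos.2 (by positivity), fun S hS x hx => ?_⟩
  obtain ⟨V, hV, hxV, hVS⟩ := 𝔾.exists_isOpen_isCompact_inter_hPerimeter_lt_top hS hx
  -- A compact Euclidean ball inside `V`, then a homogeneous ball inside its interior.
  obtain ⟨ε, hε, hεV⟩ := Metric.nhds_basis_closedBall.mem_iff.1 (hV.mem_nhds hxV)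
  obtain ⟨R₀, hR₀, hball⟩ := ϱ.exists_setOf_dist_le_subset
    (Metric.isOpen_ball (x := x) (ε := ε)) (Metric.mem_ball_self hε)
  refine ⟨R₀, hR₀, fun R hR hRR₀ φ ψ G hψ hsol φ₀ => ?_⟩
  have hcomp : ∀ r ≤ R₀, IsCompact {y | ϱ.dist x y ≤ r} ∧ {y | ϱ.dist x y ≤ r} ⊆ V := by
    intro r hr
    have hsub : {y | ϱ.dist x y ≤ r} ⊆ Metric.closedBall x ε := fun y hy =>
      Metric.ball_subset_closedBall (hball (le_trans (show ϱ.dist x y ≤ r from hy) hr))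
    exact ⟨(isCompact_closedBall x ε).of_isClosed_subset (ϱ.isClosed_setOf_dist_le x r) hsub,
      hsub.trans hεV⟩
  have hUS : ∀ᵐ y ∂((𝔾.hPerimeter S).restrict (ϱ.ball x R)), y ∈ S := by
    have hm := ((hVS _ (hcomp R hRR₀).2 (hcomp R hRR₀).1).1).measurableSet
    have h0 := 𝔾.hPerimeter_eq_zero_of_disjoint (S := S)
      ((ϱ.isOpen_ball x R).measurableSet.diff hm) (disjoint_left.2 fun y hy hyS =>
        hy.2 ⟨hyS, le_of_lt (show ϱ.dist x y < R from hy.1)⟩)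
    rw [ae_restrict_iff' (ϱ.isOpen_ball x R).measurableSet]
    refine measure_mono_null (fun y hy => ?_) h0
    have hy' : ¬(y ∈ ϱ.ball x R → y ∈ S) := hy
    push Not at hy'
    exact ⟨hy'.1, fun h => hy'.2 h.1⟩
  obtain ⟨ζ, hζ, hζ01, hζ1, hζ0, hζM⟩ := hcut x R hR
  obtain ⟨hc, hcV⟩ := hcomp (3 / 4 * R) (by linarith)
  obtain ⟨hK, hfin⟩ := hVS _ hcV hc
  have main := 𝔾.lintegral_cutoff_smul_grad_le hUS hK
    (fun y hy => ⟨hy.1, show ϱ.dist x y < R by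
      have : ϱ.dist x y ≤ 3 / 4 * R := hy.2
      linarith⟩)
    ((measure_mono inter_subset_right).trans_lt hfin) hζ
    (fun y hy => hζ0 y (not_le.1 fun h => hy.2 ⟨hy.1, h⟩)) hζ01 hR hζM hψ hsol φ₀
  refine le_trans ?_ main
  calc ∫⁻ y in ϱ.ball x (R / 2), ‖G y‖ₑ ^ 2 ∂(𝔾.hPerimeter S)
      = ∫⁻ y in ϱ.ball x (R / 2), ‖ζ y • G y‖ₑ ^ 2 ∂(𝔾.hPerimeter S) := by
        refine setLIntegral_congr_fun (ϱ.isOpen_ball x (R / 2)).measurableSet fun y hy => ?_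
        simp [hζ1 y (le_of_lt hy)]
    _ ≤ ∫⁻ y in ϱ.ball x R, ‖ζ y • G y‖ₑ ^ 2 ∂(𝔾.hPerimeter S) := by
        refine lintegral_mono_set fun y hy => ?_
        have : ϱ.dist x y < R / 2 := hy
        exact show ϱ.dist x y < R by linarith
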